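/- Let $(R,\mathfrak m)$ be a commutative Noetherian local ring and let $M$ be a nonzero finitely generated $R$-module of finite projective dimension $p$ that is locally free on the punctured spectrum, i.e. $M_{\mathfrak q}$ is a free $R_{\mathfrak q}$-module for every prime ideal $\mathfrak q\neq\mathfrak m$. For $i\ge 1$ let $M^{\otimes i}$ denote the $i$-fold tensor power of $M$ over $R$. Then $$\operatorname{depth}(M^{\otimes i})=\operatorname{depth}(R)-ip$$ for every integer $i>0$ with $ip\le\operatorname{depth}(R)$ (equivalently $0<i\le\operatorname{depth}(R)/p$ when $p>0$; every $i>0$ when $p=0$). Here $\operatorname{depth}$ is the supremum of the lengths of regular sequences on the module contained in $\mathfrak m$. -/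

import Mathlib

open scoped TensorProduct

universe u

noncomputable section

/-- The depth of a (nonzero, finitely generated) module `M` over a local ring `R` with maximal ideal
`𝔪`: the supremum of the lengths of the `M`-regular sequences all of whose entries lie in `𝔪`. -/
def moduleDepth (R M : Type*) [CommRing R] [IsLocalRing R] [AddCommGroup M] [Module R M] : ℕ∞ :=
  ⨆ rs ∈ {rs : List R | (∀ r ∈ rs, r ∈ IsLocalRing.maximalIdeal R) ∧
    RingTheory.Sequence.IsRegular M rs}, (rs.length : ℕ∞)

/-- `M` is locally free on the punctured spectrum of the local ring `R`: the localization `M_𝔮` is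
a free `R_𝔮`-module for every prime ideal `𝔮` other than the maximal ideal. -/
def IsLocallyFreeOnPuncturedSpectrum (R M : Type*) [CommRing R] [IsLocalRing R] [AddCommGroup M]
    [Module R M] : Prop :=
  ∀ (q : Ideal R) [q.IsPrime], q ≠ IsLocalRing.maximalIdeal R →
    Module.Free (Localization.AtPrime q) (LocalizedModule q.primeCompl M)

end

/-! Write k for the residue field. Depth is the least degree in which Ext(k, -) is nonzero, so it
can be tracked along long exact sequences. The key claim (`HasExtDepth.tensorProduct`) is that
tensoring with M lowers depth by p, for finite N of depth at least p; iterating it from N = R gives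
the theorem. It goes by induction on p along a minimal cover 0 → K → F → M → 0. Tensoring with N
stays exact: local freeness makes the kernel of K ⊗ N → F ⊗ N torsion, while K ⊗ N has positive
depth by induction. Since Ext(k, K ⊗ N) → Ext(k, F ⊗ N) vanishes in the critical degree, the
connecting map drops depth by one. -/

open CategoryTheory CategoryTheory.Abelian IsLocalRing Function

/-! ### Vanishing of Ext and of maps on Ext -/

section ExtDepth

variable {R : Type u} [CommRing R]

/-- `X`-depth of `N` equals `t`: `t` is the least degree in which `Ext X N` does not vanish. -/
def HasExtDepth (X N : ModuleCat.{u} R) (t : ℕ) : Prop :=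
  (∀ j < t, Subsingleton (Ext X N j)) ∧ Nontrivial (Ext X N t)

/-- A linear map induces zero on `Ext X` in degree `j`. -/
def ExtMapZero (X : ModuleCat.{u} R) {A B : Type u} [AddCommGroup A] [Module R A]
    [AddCommGroup B] [Module R B] (f : A →ₗ[R] B) (j : ℕ) : Prop :=
  ∀ x : Ext X (ModuleCat.of R A) j, x.comp (Ext.mk₀ (ModuleCat.ofHom f)) (add_zero j) = 0

variable {X : ModuleCat.{u} R} {A B C : Type u} [AddCommGroup A] [Module R A]
  [AddCommGroup B] [Module R B] [AddCommGroup C] [Module R C] {j : ℕ}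

lemma ExtMapZero.add {f g : A →ₗ[R] B} (hf : ExtMapZero X f j) (hg : ExtMapZero X g j) :
    ExtMapZero X (f + g) j := by
  intro x
  rw [ModuleCat.ofHom_add, Ext.mk₀_add, Ext.comp_add, hf x, hg x, add_zero]

lemma ExtMapZero.zero : ExtMapZero X (0 : A →ₗ[R] B) j := by
  intro x
  have : ModuleCat.ofHom (0 : A →ₗ[R] B) = 0 := rfl
  rw [this, Ext.mk₀_zero, Ext.comp_zero]

lemma ExtMapZero.sum {ι : Type*} (s : Finset ι) {f : ι → A →ₗ[R] B}
    (hf : ∀ i ∈ s, ExtMapZero X (f i) j) : ExtMapZero X (∑ i ∈ s, f i) j :=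
  Finset.sum_induction f (ExtMapZero X · j) (fun _ _ ↦ ExtMapZero.add) ExtMapZero.zero hf

lemma ExtMapZero.smul_of_mem_annihilator {r : R} (hr : r ∈ Module.annihilator R X)
    (f : A →ₗ[R] B) : ExtMapZero X (r • f) j := by
  intro x
  have hX : r • 𝟙 X = 0 := by
    ext y
    exact Module.mem_annihilator.mp hr y
  have : ModuleCat.ofHom (r • f) = r • ModuleCat.ofHom f := rfl
  rw [this, Ext.mk₀_smul, Ext.comp_smul, ← Ext.smul_comp, ← Ext.mk₀_id_comp x, ← Ext.smul_comp,
    ← Ext.mk₀_smul, hX, Ext.mk₀_zero, Ext.zero_comp, Ext.zero_comp]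

lemma ExtMapZero.comp_of_subsingleton (h : Subsingleton (Ext X (ModuleCat.of R B) j))
    (f : A →ₗ[R] B) (g : B →ₗ[R] C) : ExtMapZero X (g ∘ₗ f) j := by
  intro x
  rw [ModuleCat.ofHom_comp, ← Ext.mk₀_comp_mk₀, ← Ext.comp_assoc_of_second_deg_zero,
    Subsingleton.elim (x.comp _ _) 0, Ext.zero_comp]

lemma ExtMapZero.subsingleton (h : ExtMapZero X (LinearMap.id : A →ₗ[R] A) j) :
    Subsingleton (Ext X (ModuleCat.of R A) j) := by
  refine subsingleton_of_forall_eq 0 fun x ↦ ?_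
  have := h x
  rwa [ModuleCat.ofHom_id, Ext.comp_mk₀_id] at this

lemma subsingleton_ext_of_retract (i : A →ₗ[R] B) (r : B →ₗ[R] A) (h : r ∘ₗ i = LinearMap.id)
    (hB : Subsingleton (Ext X (ModuleCat.of R B) j)) :
    Subsingleton (Ext X (ModuleCat.of R A) j) :=
  ExtMapZero.subsingleton (h ▸ ExtMapZero.comp_of_subsingleton hB i r)

lemma subsingleton_ext_congr (e : A ≃ₗ[R] B) :
    Subsingleton (Ext X (ModuleCat.of R A) j) ↔ Subsingleton (Ext X (ModuleCat.of R B) j) :=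
  ⟨subsingleton_ext_of_retract e.symm.toLinearMap e.toLinearMap (by ext; simp),
    subsingleton_ext_of_retract e.toLinearMap e.symm.toLinearMap (by ext; simp)⟩

lemma HasExtDepth.congr {t : ℕ} (h : HasExtDepth X (ModuleCat.of R A) t) (e : A ≃ₗ[R] B) :
    HasExtDepth X (ModuleCat.of R B) t := by
  refine ⟨fun j hj ↦ (subsingleton_ext_congr e).mp (h.1 j hj), ?_⟩
  rw [← not_subsingleton_iff_nontrivial, ← subsingleton_ext_congr e,
    not_subsingleton_iff_nontrivial]
  exact h.2

section Free

variable {F K N : Type u} [AddCommGroup F] [Module R F] [Module.Free R F] [Module.Finite R F]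
  [AddCommGroup K] [Module R K] [AddCommGroup N] [Module R N]

omit [Module.Free R F] [Module.Finite R F] in
lemma LinearMap.eq_sum_coord_smulRight {ι : Type*} [Fintype ι] (b : Module.Basis ι R F)
    (f : F →ₗ[R] K) : f = ∑ i, (b.coord i).smulRight (f (b i)) := by
  refine b.ext fun j ↦ ?_
  classical
  simp [Finsupp.single_apply]

lemma subsingleton_ext_tensorProduct_of_free (h : Subsingleton (Ext X (ModuleCat.of R N) j)) :
    Subsingleton (Ext X (ModuleCat.of R (F ⊗[R] N)) j) := by
  apply ExtMapZero.subsingleton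
  let b := Module.Free.chooseBasis R F
  rw [← LinearMap.rTensor_id, LinearMap.eq_sum_coord_smulRight b LinearMap.id,
    ← LinearMap.coe_rTensorHom, map_sum]
  refine ExtMapZero.sum _ fun i _ ↦ ?_
  have : (b.coord i).smulRight (LinearMap.id (R := R) (b i)) =
    (LinearMap.toSpanSingleton R F (b i)) ∘ₗ b.coord i := by ext; simp
  rw [this, LinearMap.coe_rTensorHom, LinearMap.rTensor_comp]
  exact ExtMapZero.comp_of_subsingleton
    ((subsingleton_ext_congr (TensorProduct.lid R N)).mpr h) _ _

omit [Module.Finite R F] in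
lemma subsingleton_ext_of_tensorProduct_free [Nontrivial F]
    (h : Subsingleton (Ext X (ModuleCat.of R (F ⊗[R] N)) j)) :
    Subsingleton (Ext X (ModuleCat.of R N) j) := by
  rw [← subsingleton_ext_congr (TensorProduct.lid R N)]
  let b := Module.Free.chooseBasis R F
  obtain ⟨i⟩ := b.index_nonempty
  refine subsingleton_ext_of_retract ((LinearMap.toSpanSingleton R F (b i)).rTensor N)
    ((b.coord i).rTensor N) ?_ h
  rw [← LinearMap.rTensor_comp, ← LinearMap.rTensor_id]
  congr 1
  ext
  simp

lemma HasExtDepth.tensorProduct_of_free [Nontrivial F] {t : ℕ}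
    (h : HasExtDepth X (ModuleCat.of R N) t) : HasExtDepth X (ModuleCat.of R (F ⊗[R] N)) t := by
  refine ⟨fun j hj ↦ subsingleton_ext_tensorProduct_of_free (h.1 j hj), ?_⟩
  have := h.2
  rw [← not_subsingleton_iff_nontrivial] at this ⊢
  exact fun h' ↦ this (subsingleton_ext_of_tensorProduct_free h')

/-- In coordinates on F, `f.rTensor N` is a sum of maps scaled by elements killing X, and such
scalars act as zero on Ext from X. Minimality of a cover enters through this. -/
lemma ExtMapZero.rTensor_of_range_le (f : F →ₗ[R] K)
    (hf : LinearMap.range f ≤ Module.annihilator R X • (⊤ : Submodule R K)) :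
    ExtMapZero X (f.rTensor N) j := by
  let b := Module.Free.chooseBasis R F
  rw [LinearMap.eq_sum_coord_smulRight b f, ← LinearMap.coe_rTensorHom, map_sum]
  refine ExtMapZero.sum _ fun i _ ↦ ?_
  have hi : f (b i) ∈ Module.annihilator R X • (⊤ : Submodule R K) := hf ⟨b i, rfl⟩
  rw [LinearMap.coe_rTensorHom]
  generalize f (b i) = z at hi
  induction hi using Submodule.smul_induction_on' with
  | smul r hr y _ =>
    have : (b.coord i).smulRight (r • y) = r • (b.coord i).smulRight y := by
      ext; exact smul_comm _ _ _
    rw [this, LinearMap.rTensor_smul]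
    exact ExtMapZero.smul_of_mem_annihilator hr _
  | add y _ z _ hy hz =>
    have : (b.coord i).smulRight (y + z) = (b.coord i).smulRight y + (b.coord i).smulRight z := by
      ext; simp
    rw [this, LinearMap.rTensor_add]
    exact hy.add hz

end Free

end ExtDepth

/-! ### Depth through Ext -/

section Depth

variable {R : Type u} [CommRing R] [IsNoetherianRing R] [IsLocalRing R]
  {N : Type u} [AddCommGroup N] [Module R N] [Module.Finite R N]


omit [IsNoetherianRing R] in
lemma annihilator_quotient_maximalIdeal :
    Module.annihilator R (ModuleCat.of R (R ⧸ maximalIdeal R)) = maximalIdeal R :=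
  Ideal.annihilator_quotient

lemma exists_isRegular_iff_forall_subsingleton_ext [Nontrivial N] (n : ℕ) :
    (∃ rs : List R, rs.length = n ∧ (∀ r ∈ rs, r ∈ maximalIdeal R) ∧
      RingTheory.Sequence.IsRegular N rs) ↔
    ∀ j < n, Subsingleton (Ext (ModuleCat.of R (R ⧸ maximalIdeal R)) (ModuleCat.of R N) j) := by
  have hlt : maximalIdeal R • (⊤ : Submodule R (ModuleCat.of R N)) < ⊤ := by
    refine lt_top_iff_ne_top.mpr (Ne.symm ?_)
    exact Submodule.top_ne_ideal_smul_of_le_jacobson_annihilator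
      (IsLocalRing.maximalIdeal_le_jacobson _)
  have hsupp : Module.support R (ModuleCat.of R (R ⧸ maximalIdeal R)) =
      PrimeSpectrum.zeroLocus (maximalIdeal R) := by
    rw [Module.support_eq_zeroLocus, annihilator_quotient_maximalIdeal]
  constructor
  · rintro ⟨rs, rfl, hmem, hreg⟩
    exact ModuleCat.subsingleton_ext_of_exists_isRegular _ _ hsupp.subset _ hlt rs hmem hreg
  · exact ModuleCat.exists_isRegular_of_exists_subsingleton_ext _ n _ hlt _ hsupp

omit [IsNoetherianRing R] [IsLocalRing R] in
lemma HasExtDepth.nontrivial {X : ModuleCat.{u} R} {t : ℕ} {A : Type u} [AddCommGroup A]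
    [Module R A] (h : HasExtDepth X (ModuleCat.of R A) t) : Nontrivial A := by
  by_contra hA
  rw [not_nontrivial_iff_subsingleton] at hA
  have := h.2
  rw [← not_subsingleton_iff_nontrivial] at this
  refine this (ExtMapZero.subsingleton ?_)
  rw [Subsingleton.elim (LinearMap.id : A →ₗ[R] A) 0]
  exact ExtMapZero.zero

lemma HasExtDepth.moduleDepth_eq {t : ℕ}
    (h : HasExtDepth (ModuleCat.of R (R ⧸ maximalIdeal R)) (ModuleCat.of R N) t) :
    moduleDepth R N = t := by
  have := h.nontrivial
  apply le_antisymm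
  · refine iSup₂_le fun rs hrs ↦ ?_
    by_contra! hlt
    have := (exists_isRegular_iff_forall_subsingleton_ext rs.length).mp ⟨rs, rfl, hrs⟩ t
      (by exact_mod_cast hlt)
    exact (not_subsingleton_iff_nontrivial.mpr h.2) this
  · obtain ⟨rs, hl, hrs⟩ := (exists_isRegular_iff_forall_subsingleton_ext t).mpr h.1
    rw [← hl]
    exact le_iSup₂_of_le rs hrs le_rfl

/-- If every Ext vanished, there would be a regular sequence longer than dim R, yet each regular
element lowers the dimension by one. -/
lemma exists_hasExtDepth_self :
    ∃ t, HasExtDepth (ModuleCat.of R (R ⧸ maximalIdeal R)) (ModuleCat.of R R) t := by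
  have hex : ∃ t, Nontrivial (Ext (ModuleCat.of R (R ⧸ maximalIdeal R)) (ModuleCat.of R R) t) := by
    by_contra! hall
    obtain ⟨n, hn⟩ : ∃ n : ℕ, ringKrullDim R = n := by
      obtain ⟨d, hd⟩ := WithBot.ne_bot_iff_exists.mp (ringKrullDim_ne_bot (R := R))
      have hd' : d ≠ ⊤ := by
        rintro rfl
        exact ringKrullDim_ne_top (R := R) hd.symm
      lift d to ℕ using hd'
      exact ⟨d, hd.symm⟩
    obtain ⟨rs, hl, -, hreg⟩ :=
      (exists_isRegular_iff_forall_subsingleton_ext (R := R) (n + 1)).mpr fun j _ ↦ hall j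
    have hdim := ringKrullDim_add_length_eq_ringKrullDim_of_isRegular rs hreg
    have : Nontrivial (R ⧸ Ideal.ofList rs) := by
      refine Ideal.Quotient.nontrivial_iff.mpr fun h ↦ hreg.2 ?_
      simp [h]
    have h0 := ringKrullDim_nonneg_of_nontrivial (R := R ⧸ Ideal.ofList rs)
    have hle : ((n + 1 : ℕ) : WithBot ℕ∞) ≤ (n : ℕ) := by
      rw [← hn, ← hdim, hl]
      exact le_add_of_nonneg_left h0
    have : n + 1 ≤ n := by exact_mod_cast hle
    omega
  classical
  refine ⟨Nat.find hex, fun j hj ↦ ?_, Nat.find_spec hex⟩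
  exact not_nontrivial_iff_subsingleton.mp (Nat.find_min hex hj)

end Depth

/-! ### Minimal covers and local freeness -/

section Syzygy

variable {R : Type u} [CommRing R] [IsLocalRing R]

lemma exists_minimal_free_cover (M : Type u) [AddCommGroup M] [Module R M] [Module.Finite R M] :
    ∃ (n : ℕ) (g : (Fin n → R) →ₗ[R] M), Surjective g ∧
      LinearMap.ker g ≤ maximalIdeal R • (⊤ : Submodule R (Fin n → R)) := by
  let b := Module.finBasis (ResidueField R) (ResidueField R ⊗[R] M)
  have hsurj := TensorProduct.mk_surjective R M (ResidueField R) residue_surjective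
  choose v hv using fun i ↦ hsurj (b i)
  refine ⟨_, Fintype.linearCombination R v, ?_, fun c hc ↦ ?_⟩
  · rw [← LinearMap.range_eq_top, Fintype.range_linearCombination]
    exact span_eq_top_of_tmul_eq_basis v b hv
  · have h0 : ∑ i, residue R (c i) • b i = 0 := by
      have := congrArg (TensorProduct.mk R (ResidueField R) M 1) (LinearMap.mem_ker.mp hc)
      rw [Fintype.linearCombination_apply, map_sum, map_zero] at this
      rw [← this]
      refine Finset.sum_congr rfl fun i _ ↦ ?_
      rw [map_smul, hv]
      rfl
    have hmem : ∀ i, c i ∈ maximalIdeal R := fun i ↦ by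
      rw [← residue_eq_zero_iff]
      exact Fintype.linearIndependent_iff.mp b.linearIndependent _ h0 i
    rw [pi_eq_sum_univ' c]
    exact Submodule.sum_mem _ fun i _ ↦ Submodule.smul_mem_smul (hmem i) trivial

variable {M : Type u} [AddCommGroup M] [Module R M]

/-- Multiplication on `M` by some power of each element of the maximal ideal lifts along every
surjection from a finite free module onto `M`. -/
def IsStablyTorsion (R M : Type u) [CommRing R] [IsLocalRing R] [AddCommGroup M] [Module R M] :
    Prop :=
  ∀ (n : ℕ) (g : (Fin n → R) →ₗ[R] M), Surjective g → ∀ r ∈ maximalIdeal R,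
    ∃ (m : ℕ) (h : M →ₗ[R] (Fin n → R)), g ∘ₗ h = r ^ m • LinearMap.id

lemma IsLocallyFreeOnPuncturedSpectrum.isStablyTorsion [IsNoetherianRing R] [Module.Finite R M]
    (hM : IsLocallyFreeOnPuncturedSpectrum R M) : IsStablyTorsion R M := by
  intro n g hg
  -- I consists of the scalars whose action on M factors through g. It lies in no prime other than
  -- 𝔪, so its radical contains 𝔪.
  let I : Ideal R := (LinearMap.range (g.compRight R (M := M))).comap
    (LinearMap.toSpanSingleton R (M →ₗ[R] M) LinearMap.id)
  have hI : ∀ (q : Ideal R) [q.IsPrime], q ≠ maximalIdeal R → ¬ I ≤ q := by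
    intro q _ hq hle
    have := hM q hq
    have hgq : Surjective (LocalizedModule.map q.primeCompl g) :=
      LocalizedModule.map_surjective q.primeCompl g hg
    -- Split g at q, then clear denominators: some scalar outside q lies in I.
    obtain ⟨σ, hσ⟩ := Module.projective_lifting_property (LocalizedModule.map q.primeCompl g)
      LinearMap.id hgq
    have := Module.finitePresentation_of_finite R M
    obtain ⟨h, s, hs⟩ := Module.FinitePresentation.exists_lift_of_isLocalizedModule q.primeCompl
      (LocalizedModule.mkLinearMap q.primeCompl (Fin n → R))
      (σ.restrictScalars R ∘ₗ LocalizedModule.mkLinearMap q.primeCompl M)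
    have hcomp : LocalizedModule.mkLinearMap q.primeCompl M ∘ₗ (g ∘ₗ h) =
        LocalizedModule.mkLinearMap q.primeCompl M ∘ₗ (s • LinearMap.id) := by
      ext x
      have h1 : LocalizedModule.mkLinearMap q.primeCompl (Fin n → R) (h x) =
          (s : R) • σ (LocalizedModule.mkLinearMap q.primeCompl M x) := LinearMap.congr_fun hs x
      have h2 : LocalizedModule.map q.primeCompl g
          (LocalizedModule.mkLinearMap q.primeCompl (Fin n → R) (h x)) =
          LocalizedModule.mkLinearMap q.primeCompl M (g (h x)) := by
        simp [LocalizedModule.map_mk]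
      have h3 := LinearMap.congr_fun hσ (LocalizedModule.mkLinearMap q.primeCompl M x)
      rw [LinearMap.comp_apply, LinearMap.comp_apply, ← h2, h1, LinearMap.map_smul_of_tower]
      rw [LinearMap.comp_apply, LinearMap.id_apply] at h3
      rw [h3, ← map_smul]
      rfl
    obtain ⟨t, ht⟩ := Module.Finite.exists_smul_of_comp_eq_of_isLocalizedModule q.primeCompl
      (LocalizedModule.mkLinearMap q.primeCompl M) _ _ hcomp
    refine (t * s).2 (hle ⟨t • h, ?_⟩)
    ext x
    have := LinearMap.congr_fun ht x
    simpa [Submonoid.smul_def, mul_smul] using this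
  intro r hr
  have hrad : r ∈ I.radical := by
    rw [Ideal.radical_eq_sInf, Submodule.mem_sInf]
    rintro q ⟨hIq, hq⟩
    by_contra hrq
    exact hI q (fun h ↦ hrq (h ▸ hr)) hIq
  obtain ⟨m, h, hh⟩ := hrad
  exact ⟨m, h, hh⟩

/-- Multiplication by `r ^ m` on the kernel of a free cover extends to the cover. -/
lemma IsStablyTorsion.exists_extension (hM : IsStablyTorsion R M) {n : ℕ}
    (g : (Fin n → R) →ₗ[R] M) (hg : Surjective g) {r : R} (hr : r ∈ maximalIdeal R) :
    ∃ (m : ℕ) (ρ : (Fin n → R) →ₗ[R] LinearMap.ker g),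
      ρ ∘ₗ (LinearMap.ker g).subtype = r ^ m • LinearMap.id := by
  obtain ⟨m, h, hh⟩ := hM n g hg r hr
  refine ⟨m, LinearMap.codRestrict _ (r ^ m • LinearMap.id - h ∘ₗ g) fun x ↦ ?_, ?_⟩
  · have := LinearMap.congr_fun hh (g x)
    simp only [LinearMap.comp_apply, LinearMap.smul_apply, LinearMap.id_apply] at this
    simp [this]
  · refine LinearMap.ext fun x ↦ Subtype.ext ?_
    simp

lemma IsStablyTorsion.ker (hM : IsStablyTorsion R M) {n : ℕ}
    (g : (Fin n → R) →ₗ[R] M) (hg : Surjective g) : IsStablyTorsion R (LinearMap.ker g) := by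
  intro n' g' hg' r hr
  obtain ⟨m, ρ, hρ⟩ := hM.exists_extension g hg hr
  obtain ⟨ρ', hρ'⟩ := Module.projective_lifting_property g' ρ hg'
  exact ⟨m, ρ' ∘ₗ (LinearMap.ker g).subtype, by rw [← LinearMap.comp_assoc, hρ', hρ]⟩

end Syzygy

/-! ### Depth of tensor products -/

section Tensor

variable {R : Type u} [CommRing R] [IsNoetherianRing R] [IsLocalRing R]
  {M N : Type u} [AddCommGroup M] [Module R M] [AddCommGroup N] [Module R N]

/-- Multiplication by r ^ m on K ⊗ N factors through F ⊗ N, so it kills the kernel; choosing r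
regular on K ⊗ N makes the kernel zero. -/
lemma IsStablyTorsion.rTensor_subtype_injective [Module.Finite R N] (hM : IsStablyTorsion R M)
    {n : ℕ} (g : (Fin n → R) →ₗ[R] M) (hg : Surjective g) {t : ℕ}
    (ht : HasExtDepth (ModuleCat.of R (R ⧸ maximalIdeal R))
      (ModuleCat.of R (LinearMap.ker g ⊗[R] N)) (t + 1)) :
    Injective ((LinearMap.ker g).subtype.rTensor N) := by
  have := ht.nontrivial
  obtain ⟨rs, hl, hrs, hreg⟩ := (exists_isRegular_iff_forall_subsingleton_ext 1).mpr
    fun j hj ↦ ht.1 j (by omega)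
  obtain ⟨r, rfl⟩ := List.length_eq_one_iff.mp hl
  have hr : IsSMulRegular (LinearMap.ker g ⊗[R] N) r :=
    ((RingTheory.Sequence.isRegular_cons_iff _ _ _).mp hreg).1
  obtain ⟨m, ρ, hρ⟩ := hM.exists_extension g hg (hrs r (by simp))
  rw [injective_iff_map_eq_zero]
  intro x hx
  have h1 : (ρ ∘ₗ (LinearMap.ker g).subtype).rTensor N x = 0 := by
    rw [LinearMap.rTensor_comp, LinearMap.comp_apply, hx, map_zero]
  rw [hρ, LinearMap.rTensor_smul, LinearMap.rTensor_id] at h1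
  exact (hr.pow m).right_eq_zero_of_smul h1

omit [IsNoetherianRing R] [IsLocalRing R] in
lemma HasExtDepth.of_exact {X : ModuleCat.{u} R} {A B C : Type u} [AddCommGroup A] [Module R A]
    [AddCommGroup B] [Module R B] [AddCommGroup C] [Module R C] {f : A →ₗ[R] B} {g : B →ₗ[R] C}
    (hf : Injective f) (hfg : Exact f g) (hg : Surjective g) {t : ℕ}
    (hA : HasExtDepth X (ModuleCat.of R A) (t + 1))
    (hB : ∀ j ≤ t, Subsingleton (Ext X (ModuleCat.of R B) j)) (h0 : ExtMapZero X f (t + 1)) :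
    HasExtDepth X (ModuleCat.of R C) t := by
  let S : ShortComplex (ModuleCat.{u} R) :=
    ShortComplex.mk (ModuleCat.ofHom f) (ModuleCat.ofHom g) (by
      rw [← ModuleCat.ofHom_comp, hfg.linearMap_comp_eq_zero]
      rfl)
  have hS : S.ShortExact :=
    { exact := (ShortComplex.ShortExact.moduleCat_exact_iff_function_exact S).mpr hfg
      mono_f := (ModuleCat.mono_iff_injective _).mpr hf
      epi_g := (ModuleCat.epi_iff_surjective _).mpr hg }
  constructor
  · intro j hj
    refine subsingleton_of_forall_eq 0 fun x ↦ ?_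
    have := hA.1 (j + 1) (by omega)
    obtain ⟨y, rfl⟩ := Ext.covariant_sequence_exact₃ X hS x rfl (Subsingleton.elim _ _)
    have := hB j hj.le
    have hy : y = 0 := Subsingleton.elim (α := Ext X (ModuleCat.of R B) j) _ _
    rw [hy, Ext.zero_comp]
  · have := hA.2
    obtain ⟨x, hx⟩ := exists_ne (0 : Ext X (ModuleCat.of R A) (t + 1))
    obtain ⟨y, rfl⟩ := Ext.covariant_sequence_exact₁ X hS x (h0 x) rfl
    refine ⟨y, 0, ?_⟩
    rintro rfl
    exact hx (by rw [Ext.zero_comp])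

theorem HasExtDepth.tensorProduct [Module.Finite R M] [Module.Finite R N]
    (hM : IsStablyTorsion R M) {p t : ℕ}
    (hp : HasProjectiveDimensionLT (ModuleCat.of R M) (p + 1))
    (hp' : ¬ HasProjectiveDimensionLT (ModuleCat.of R M) p)
    (hN : HasExtDepth (ModuleCat.of R (R ⧸ maximalIdeal R)) (ModuleCat.of R N) (t + p)) :
    HasExtDepth (ModuleCat.of R (R ⧸ maximalIdeal R)) (ModuleCat.of R (M ⊗[R] N)) t := by
  induction p generalizing M t with
  | zero =>
    rw [← projective_iff_hasProjectiveDimensionLT_one, ← IsProjective.iff_projective] at hp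
    -- At p = 0 the lower bound on projective dimension says exactly that M is nonzero.
    rw [hasProjectiveDimensionLT_zero_iff_isZero, ModuleCat.isZero_iff_subsingleton,
      not_subsingleton_iff_nontrivial] at hp'
    have : Nontrivial M := hp'
    have : Module.Projective R M := hp
    have : Module.Free R M := Module.free_of_flat_of_isLocalRing
    exact hN.tensorProduct_of_free
  | succ p ih =>
    obtain ⟨n, g, hg, hmin⟩ := exists_minimal_free_cover (R := R) M
    have hS := LinearMap.shortExact_shortComplexKer hg
    have hproj : HasProjectiveDimensionLT (ModuleCat.of R (Fin n → R)) 1 := by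
      rw [← projective_iff_hasProjectiveDimensionLT_one, ← IsProjective.iff_projective]
      infer_instance
    have hK : HasProjectiveDimensionLT (ModuleCat.of R (LinearMap.ker g)) (p + 1) :=
      hS.hasProjectiveDimensionLT_X₁ (p + 1)
        (hasProjectiveDimensionLT_of_ge _ 1 (p + 1) (by omega)) hp
    have hK' : ¬ HasProjectiveDimensionLT (ModuleCat.of R (LinearMap.ker g)) p := fun h ↦
      hp' (hS.hasProjectiveDimensionLT_X₃ p h
        (hasProjectiveDimensionLT_of_ge _ 1 (p + 1) (by omega)))
    have hdepth := ih (hM.ker g hg) (t := t + 1) hK hK' (by rwa [add_right_comm, add_assoc])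
    have hinj := hM.rTensor_subtype_injective g hg hdepth
    refine HasExtDepth.of_exact hinj (rTensor_exact N (LinearMap.exact_subtype_ker_map g) hg)
      (LinearMap.rTensor_surjective N hg) hdepth
      (fun j hj ↦ subsingleton_ext_tensorProduct_of_free (hN.1 j (by omega))) ?_
    -- If p = 0, N has depth exactly t + 1, so the target Ext is nonzero and minimality of the cover
    -- is needed; if p > 0, the target vanishes.
    obtain rfl | hpos := Nat.eq_zero_or_pos p
    · rw [← projective_iff_hasProjectiveDimensionLT_one, ← IsProjective.iff_projective] at hK
      have : Module.Projective R (LinearMap.ker g) := hK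
      have : Module.Free R (LinearMap.ker g) := Module.free_of_flat_of_isLocalRing
      apply ExtMapZero.rTensor_of_range_le
      rwa [Submodule.range_subtype, annihilator_quotient_maximalIdeal]
    · intro x
      have : Subsingleton (Ext (ModuleCat.of R (R ⧸ maximalIdeal R))
          (ModuleCat.of R ((Fin n → R) ⊗[R] N)) (t + 1)) :=
        subsingleton_ext_tensorProduct_of_free (hN.1 _ (by omega))
      exact Subsingleton.elim _ _

lemma hasExtDepth_tensorPower [Module.Finite R M] (hM : IsStablyTorsion R M) {p : ℕ}
    (hp : HasProjectiveDimensionLT (ModuleCat.of R M) (p + 1))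
    (hp' : ¬ HasProjectiveDimensionLT (ModuleCat.of R M) p) (i : ℕ) {t : ℕ}
    (h : HasExtDepth (ModuleCat.of R (R ⧸ maximalIdeal R)) (ModuleCat.of R R) (t + i * p)) :
    HasExtDepth (ModuleCat.of R (R ⧸ maximalIdeal R)) (ModuleCat.of R (⨂[R]^i M)) t := by
  induction i generalizing t with
  | zero =>
    rw [zero_mul, add_zero] at h
    exact h.congr (PiTensorProduct.isEmptyEquiv (Fin 0)).symm
  | succ i ih =>
    have hi := ih (t := t + p) (by convert h using 1; ring)
    exact (HasExtDepth.tensorProduct hM hp hp' hi).congr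
      ((TensorProduct.comm R _ _).trans ((LinearEquiv.lTensor _
        (PiTensorProduct.subsingletonEquiv (0 : Fin 1)).symm).trans TensorPower.mulEquiv))

end Tensor

theorem mainTheorem8 {R : Type u} [CommRing R] [IsNoetherianRing R] [IsLocalRing R]
    {M : Type u} [AddCommGroup M] [Module R M] [Module.Finite R M]
    (hM : IsLocallyFreeOnPuncturedSpectrum R M)
    (p : ℕ) (hp : CategoryTheory.projectiveDimension (ModuleCat.of R M) = (p : WithBot ℕ∞))
    (i : ℕ) (hi : 0 < i) (hip : ((i * p : ℕ) : ℕ∞) ≤ moduleDepth R R) :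
    moduleDepth R (⨂[R]^i M) = moduleDepth R R - ((i * p : ℕ) : ℕ∞) := by
  obtain ⟨d, hd⟩ := exists_hasExtDepth_self (R := R)
  rw [hd.moduleDepth_eq] at hip ⊢
  obtain ⟨t, rfl⟩ := Nat.exists_eq_add_of_le' (Nat.cast_le.mp hip)
  have hle := (projectiveDimension_le_iff (ModuleCat.of R M) p).mp hp.le
  have hge := (projectiveDimension_ge_iff (ModuleCat.of R M) p).mp hp.ge
  rw [(hasExtDepth_tensorPower hM.isStablyTorsion hle hge i hd).moduleDepth_eq, ← ENat.natCast_sub,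
    Nat.add_sub_cancel]
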